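/- Let \(G\) be a connected \(d\)-dimensional Lie group with a left-invariant vector-field basis \(D^1,\dots,D^d\), a left Haar (volume) measure \(\mu\), and modular function \(\Delta\), where \(\mu(Sg)=\Delta(g)\mu(S)\). Let \(\mathcal H_k\) be a real reproducing kernel Hilbert space on \(G\) with kernel \(k\in C^2(G\times G)\). For a locally Lipschitz probability density \(p\) (all densities are with respect to \(\mu\)) put \[ \mathcal A^l_p h = D^l h + h\,D^l\log p + h\,D^l\Delta ,\qquad \mathcal A_p f=\sum_{l=1}^d \mathcal A^l_p f_l\quad (f=(f_1,\dots,f_d)\in\mathcal H_k^d), \] where \(D^l\log p\) is set to \(0\) at points where \(p=0\) or where \(p\) is not differentiable. Let \(k_p(x,y)=\sum_{l=1}^d \tilde{\mathcal A}^l_p\mathcal A^l_p k(x,y)\), where \(\mathcal A_p^l\) acts on the first argument of \(k\) and \(\tilde{\mathcal A}^l_p\) is the same operator acting on the second one, and let \[ \mathrm{KSD}(p,q)=\sup\Big\{\int_G \mathcal A_p f\; q\,d\mu : f\in\mathcal H_k^d,\ \|f\|_{\mathcal H_k^d}\le 1\Big\}. \] Let \((\Theta,d)\) be a metric space, \((p_\theta)_{\theta\in\Theta}\)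 a family of locally Lipschitz probability densities, \(q\) a locally Lipschitz probability density, and \(w\) a probability density with \(q=0\) \(\mu\)-a.e. on \(\{w=0\}\). Let \(x_1,x_2,\dots\) be i.i.d. with density \(w\), and put \[ V_\theta(x,y)=\frac{k_{p_\theta}(x,y)\,q(x)\,q(y)}{w(x)\,w(y)},\qquad \mathrm{wKSD}_n^2(\theta)=\frac1{n^2}\sum_{i,j=1}^n V_\theta(x_i,x_j),\qquad \mathrm{KSD}(\theta)=\mathrm{KSD}(p_\theta,q), \] with \(V_\theta(x,y):=0\) if \(w(x)w(y)=0\). Suppose that \((\theta,x,y)\mapsto V_\theta(x,y)\) is jointly continuous on \(\Theta\times\{w>0\}\times\{w>0\}\), and that \(x\mapsto\sup_{\theta\in K}V_\theta(x,x)\) is \(w\)-integrable for every compact \(K\subset\Theta\). Then: 1. For every \(\theta\), \(\mathcal A_{p_\theta}f\) is \(q\)-integrable for every \(f\in\mathcal H_k^d\), and \(\mathrm{KSD}(\theta)<\infty\). 2. For every compact \(K\subset\Theta\), almost surely, \(\mathrm{wKSD}_n^2(\theta)\to\mathrm{KSD}^2(\theta)\) uniformly on \(K\). 3. If \(\Theta\)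 is locally compact, then every \(\mathrm{wKSD}_n\) (for every realization of the sample) and \(\mathrm{KSD}\) are continuous on \(\Theta\). -/

import Mathlib

open MeasureTheory ProbabilityTheory Filter Topology
open scoped Manifold ContDiff ENNReal

noncomputable section

namespace LieKSD

/-- `p` is a probability density with respect to `μ`. -/
structure IsProbDensity {G : Type*} [MeasurableSpace G] (μ : Measure G) (p : G → ℝ) : Prop where
  measurable : Measurable p
  nonneg : ∀ x, 0 ≤ p x
  lintegral_eq_one : ∫⁻ x, ENNReal.ofReal (p x) ∂μ = 1

/-- The distribution `p dμ` with density `p`. -/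
def distr {G : Type*} [MeasurableSpace G] (μ : Measure G) (p : G → ℝ) : Measure G :=
  μ.withDensity (fun x => ENNReal.ofReal (p x))

section LieGroup

variable {E : Type*} [NormedAddCommGroup E] [NormedSpace ℝ E]
  {G : Type*} [TopologicalSpace G] [ChartedSpace E G]

variable (E) in
/-- Local Lipschitz continuity of a function on a manifold: around each point, the function read in
the chart at that point is Lipschitz. (Smooth changes of charts preserve this.) -/
def LocLipschitz (f : G → ℝ) : Prop :=
  ∀ x : G, ∃ C : NNReal, ∃ t ∈ 𝓝 (extChartAt 𝓘(ℝ, E) x x),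
    LipschitzOnWith C (f ∘ (extChartAt 𝓘(ℝ, E) x).symm) t

variable [Group G]

/-- The derivative `D f` of a function `f` along the left-invariant vector field `D` whose value at
the identity is `v`. -/
def lieD (v : GroupLieAlgebra 𝓘(ℝ, E) G) (f : G → ℝ) (x : G) : ℝ :=
  mfderiv 𝓘(ℝ, E) 𝓘(ℝ, ℝ) f x (mulInvariantVectorField v x)

/-- `D log p`, set to `0` where `p = 0` (and, by the convention for `mfderiv`, at the points of
non-differentiability, which form a null set if `p` is locally Lipschitz). -/
def score (v : GroupLieAlgebra 𝓘(ℝ, E) G) (p : G → ℝ) (x : G) : ℝ :=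
  open Classical in
  if p x = 0 then 0 else lieD v (fun y => Real.log (p y)) x

variable [FiniteDimensional ℝ E] [LieGroup 𝓘(ℝ, E) ∞ G]

variable (E) in
/-- The modular function `Δ`, normalised by `R_g^* Ω = Δ_g Ω` for a left-invariant volume form `Ω`,
i.e. `μ (S g) = Δ_g μ (S)` for a left Haar measure `μ`. Mathlib's modular character is normalised by
`μ (S g⁻¹) = modularCharacterFun g * μ (S)`, whence the inverse. -/
def modularFn (g : G) : ℝ :=
  haveI : IsTopologicalGroup G := topologicalGroup_of_lieGroup 𝓘(ℝ, E) ∞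
  haveI : LocallyCompactSpace G := Manifold.locallyCompact_of_finiteDimensional 𝓘(ℝ, E)
  (Measure.modularCharacterFun g⁻¹ : NNReal)

/-- The component `h ↦ D h + h D log p + h D Δ` of the Stein operator, for the left-invariant field
`D` with value `v` at the identity. -/
def steinOp (v : GroupLieAlgebra 𝓘(ℝ, E) G) (p h : G → ℝ) (x : G) : ℝ :=
  lieD v h x + h x * score v p x + h x * lieD v (modularFn E) x

end LieGroup

section Kernel

variable {G : Type*} (H : Type*) [NormedAddCommGroup H] [InnerProductSpace ℝ H] [CompleteSpace H]
  [RKHS ℝ H G ℝ]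

/-- The scalar reproducing kernel `k` of the real reproducing kernel Hilbert space `H` on `G`. -/
def kernelFn (x y : G) : ℝ := RKHS.kernel H x y 1

variable {E : Type*} [NormedAddCommGroup E] [NormedSpace ℝ E] [FiniteDimensional ℝ E]
  [TopologicalSpace G] [ChartedSpace E G] [Group G] [LieGroup 𝓘(ℝ, E) ∞ G]
  {d : ℕ} (b : Module.Basis (Fin d) ℝ (GroupLieAlgebra 𝓘(ℝ, E) G))

/-- The Stein kernel `k_p`: for each `l` the component `A_p^l` acts on the first argument of `k`,
then on the second one, and the results are summed over `l`. -/
def steinKernel (p : G → ℝ) (x y : G) : ℝ :=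
  ∑ l, steinOp (b l) p (fun y' => steinOp (b l) p (fun x' => kernelFn H x' y') x) y

variable {H} in
/-- The Stein operator `A_p f = ∑ l, A_p^l f_l` for `f` in the Hilbert space product `H^d`. -/
def steinOpVec (p : G → ℝ) (f : PiLp 2 (fun _ : Fin d => H)) (x : G) : ℝ :=
  ∑ l, steinOp (b l) p (f l) x

/-- The kernel Stein discrepancy: the supremum of `E_q [A_p f]` over the unit ball of `H^d`. -/
def ksd [MeasurableSpace G] (μ : Measure G) (p q : G → ℝ) : ℝ :=
  sSup {r : ℝ | ∃ f : PiLp 2 (fun _ : Fin d => H), ‖f‖ ≤ 1 ∧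
    r = ∫ x, steinOpVec b p f x * q x ∂μ}

/-- `V (x, y) = k_p (x, y) q (x) q (y) / (w (x) w (y))`. -/
def weightedKernel (p q w : G → ℝ) (x y : G) : ℝ :=
  steinKernel H b p x y * q x * q y * (w x)⁻¹ * (w y)⁻¹

/-- The squared weighted empirical discrepancy of the sample points `x 0, …, x (n - 1)`. -/
def wksdSq (p q w : G → ℝ) (n : ℕ) (x : ℕ → G) : ℝ :=
  1 / (n : ℝ) ^ 2 * ∑ i ∈ Finset.range n, ∑ j ∈ Finset.range n,
    weightedKernel H b p q w (x i) (x j)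

/-- The weighted empirical discrepancy. -/
def wksd (p q w : G → ℝ) (n : ℕ) (x : ℕ → G) : ℝ := √(wksdSq H b p q w n x)

end Kernel

end LieKSD

end

/-! The discrepancy and its empirical version are norms of means in `H^d`. Since `k` is `C²`,
derivative evaluations on `H` are bounded and have Riesz representers. Hence `steinOpVec b p f x =
⟪Φ x, f⟫` with `⟪Φ x, Φ y⟫` the Stein kernel (`exists_stein_feature`). With `Ψ = (q/w) Φ`, `KSD` is
the norm of the mean of `Ψ` under `w` (`ksd_eq_norm_integral`), and `wKSD²` is the squared norm of
the sample mean (`wksdSq_eq_norm_sq`). The envelope `√(sup V(x,x))` dominates `‖Ψ‖`, giving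
integrability.

Joint continuity of `V` controls `⟪Ψ_θ x, Ψ_θ y⟫` only for a common `θ`, so a law of large numbers
for `θ ↦ Ψ_θ x` as a random continuous map is not directly at hand. Instead, after cutting off to a
compact set, the scalar functions `(θ, y) ↦ ⟪Ψ_θ x, Ψ_θ y⟫` obey a strong law in a space of
continuous functions, applied once for each argument of the kernel. The envelope makes the cut-off
error uniformly small (`ae_tendstoUniformly_norm_sampleMean_sq`). Continuity of `KSD` then follows
from uniform limits. -/

namespace LieKSD

open scoped RealInnerProductSpace

/-! ### Weak differentiability from a `C²` Gram kernel -/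

section WeakDerivative

variable {E : Type*} [NormedAddCommGroup E] [NormedSpace ℝ E]
  {F : Type*} [NormedAddCommGroup F] [InnerProductSpace ℝ F]

/-- A twice differentiable nonnegative function vanishing at a point is quadratically small there. -/
theorem isBigO_sq_of_contDiffAt_two {f : E → ℝ} {u₀ : E} (hf : ContDiffAt ℝ 2 f u₀)
    (h0 : f u₀ = 0) (hpos : ∀ u, 0 ≤ f u) : f =O[𝓝 u₀] fun u => ‖u - u₀‖ ^ 2 := by
  have hmin : IsLocalMin f u₀ := Eventually.of_forall fun u => by rw [h0]; exact hpos u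
  have hd0 : fderiv ℝ f u₀ = 0 := hmin.fderiv_eq_zero
  have hd1 : ContDiffAt ℝ 1 (fderiv ℝ f) u₀ := hf.fderiv_right (by norm_num)
  obtain ⟨C, t, ht, hC⟩ := hd1.exists_lipschitzOnWith
  have hev : ∀ᶠ u in 𝓝 u₀, DifferentiableAt ℝ f u := by
    filter_upwards [hf.eventually (by simp)] with u hu
    exact hu.differentiableAt (by norm_num)
  obtain ⟨r, hr, hball⟩ := Metric.mem_nhds_iff.1 (inter_mem ht hev)
  refine Asymptotics.IsBigO.of_bound C ?_
  filter_upwards [Metric.ball_mem_nhds u₀ hr] with u hu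
  -- On this ball the derivative, being Lipschitz and zero at `u₀`, is at most `C * dist u u₀`; the
  -- mean value inequality supplies the second factor.
  have hsub : Metric.closedBall u₀ (dist u u₀) ⊆ Metric.ball u₀ r :=
    Metric.closedBall_subset_ball hu
  have := (convex_closedBall u₀ (dist u u₀)).norm_image_sub_le_of_norm_hasFDerivWithin_le
    (f := f) (f' := fderiv ℝ f) (C := C * dist u u₀)
    (fun x hx => ((hball (hsub hx)).2.hasFDerivAt).hasFDerivWithinAt)
    (fun x hx => by
      have h1 := hC.dist_le_mul x (hball (hsub hx)).1 u₀ (mem_of_mem_nhds ht)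
      rw [hd0, dist_zero_right] at h1
      exact h1.trans (by gcongr; exact hx))
    (Metric.mem_closedBall_self dist_nonneg) (Metric.mem_closedBall.2 le_rfl)
  rw [h0, sub_zero, dist_eq_norm] at this
  rw [Real.norm_of_nonneg (by positivity : 0 ≤ ‖u - u₀‖ ^ 2)]
  linarith [this]

/-- A map into an inner product space is Lipschitz at a point where its Gram kernel is `C²`. -/
theorem isBigO_sub_of_contDiffAt_inner {κ : E → F} {u₀ : E}
    (h : ContDiffAt ℝ 2 (fun z : E × E => ⟪κ z.1, κ z.2⟫) (u₀, u₀)) :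
    (fun u => κ u - κ u₀) =O[𝓝 u₀] fun u => u - u₀ := by
  have h1 : ContDiffAt ℝ 2 (fun u => ⟪κ u, κ u⟫) u₀ :=
    ContDiffAt.comp (f := fun u : E => (u, u)) u₀ h (contDiffAt_id.prodMk contDiffAt_id)
  have h2 : ContDiffAt ℝ 2 (fun u => ⟪κ u, κ u₀⟫) u₀ :=
    ContDiffAt.comp (f := fun u : E => (u, u₀)) u₀ h (contDiffAt_id.prodMk contDiffAt_const)
  have h3 : ContDiffAt ℝ 2 (fun u => ‖κ u - κ u₀‖ ^ 2) u₀ := by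
    have : (fun u => ‖κ u - κ u₀‖ ^ 2)
        = fun u => ⟪κ u, κ u⟫ - 2 * ⟪κ u, κ u₀⟫ + ⟪κ u₀, κ u₀⟫ := by
      ext u
      rw [norm_sub_sq_real, real_inner_self_eq_norm_sq, real_inner_self_eq_norm_sq]
    rw [this]
    exact (h1.sub (contDiffAt_const.mul h2)).add contDiffAt_const
  have h4 := isBigO_sq_of_contDiffAt_two h3 (by simp) (fun u => by positivity)
  have h5 : (fun u => ‖κ u - κ u₀‖) =O[𝓝 u₀] fun u => ‖u - u₀‖ :=
    h4.of_pow two_ne_zero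
  exact h5.of_norm_norm

/-- If a map is Lipschitz at a point, then the vectors against which it is weakly differentiable
there form a closed set. -/
theorem isClosed_setOf_differentiableAt_inner {κ : E → F} {u₀ : E}
    (h : (fun u => κ u - κ u₀) =O[𝓝 u₀] fun u => u - u₀) :
    IsClosed {f : F | DifferentiableAt ℝ (fun u => ⟪f, κ u⟫) u₀} := by
  obtain ⟨C, hC0, hC⟩ := h.exists_nonneg
  have hC := hC.bound
  have hlip : ∀ f : F, ∀ᶠ u in 𝓝 u₀, ‖⟪f, κ u⟫ - ⟪f, κ u₀⟫‖ ≤ C * ‖f‖ * ‖u - u₀‖ := by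
    intro f
    filter_upwards [hC] with u hu
    rw [← inner_sub_right]
    refine (norm_inner_le_norm _ _).trans ?_
    calc ‖f‖ * ‖κ u - κ u₀‖ ≤ ‖f‖ * (C * ‖u - u₀‖) := by gcongr
      _ = _ := by ring
  refine IsSeqClosed.isClosed fun f g hf hg => ?_
  -- The Lipschitz bound is linear in `‖f‖`, so convergence of the vectors forces convergence of the
  -- derivatives.
  have hd : ∀ n m, ‖fderiv ℝ (fun u => ⟪f n, κ u⟫) u₀ - fderiv ℝ (fun u => ⟪f m, κ u⟫) u₀‖
      ≤ C * ‖f n - f m‖ := by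
    intro n m
    have := (hf n).hasFDerivAt.sub (hf m).hasFDerivAt
    refine this.le_of_lip' (by positivity) ?_
    filter_upwards [hlip (f n - f m)] with u hu
    simpa [inner_sub_left] using hu
  have hcau : CauchySeq fun n => fderiv ℝ (fun u => ⟪f n, κ u⟫) u₀ := by
    rw [Metric.cauchySeq_iff]
    intro ε hε
    -- `C + 1` because `C` may be zero.
    obtain ⟨N, hN⟩ := Metric.cauchySeq_iff.1 hg.cauchySeq (ε / (C + 1)) (by positivity)
    refine ⟨N, fun m hm n hn => ?_⟩
    have h1 := hN m hm n hn
    rw [dist_eq_norm] at h1 ⊢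
    refine (hd m n).trans_lt ?_
    rw [lt_div_iff₀ (by positivity)] at h1
    nlinarith [norm_nonneg (f m - f n)]
  obtain ⟨L, hL⟩ := cauchySeq_tendsto_of_complete hcau
  refine HasFDerivAt.differentiableAt (f' := L) ?_
  rw [hasFDerivAt_iff_isLittleO, Asymptotics.isLittleO_iff]
  intro ε hε
  have e1 : ∀ᶠ n in atTop, C * ‖g - f n‖ < ε / 3 := by
    have : Tendsto (fun n => C * ‖g - f n‖) atTop (𝓝 (C * ‖g - g‖)) :=
      (tendsto_const_nhds.sub hg).norm.const_mul C
    rw [sub_self, norm_zero, mul_zero] at this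
    exact this.eventually_lt_const (by positivity)
  have e2 : ∀ᶠ n in atTop, ‖fderiv ℝ (fun u => ⟪f n, κ u⟫) u₀ - L‖ < ε / 3 := by
    have := (hL.sub_const L).norm
    rw [sub_self, norm_zero] at this
    exact this.eventually_lt_const (by positivity)
  obtain ⟨n, hn1, hn2⟩ := (e1.and e2).exists
  have e3 := Asymptotics.isLittleO_iff.1
    (hasFDerivAt_iff_isLittleO.1 (hf n).hasFDerivAt) (c := ε / 3) (by positivity)
  filter_upwards [e3, hlip (g - f n)] with u hu1 hu2
  have key : ⟪g, κ u⟫ - ⟪g, κ u₀⟫ - L (u - u₀)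
      = (⟪g - f n, κ u⟫ - ⟪g - f n, κ u₀⟫)
        + (⟪f n, κ u⟫ - ⟪f n, κ u₀⟫ - fderiv ℝ (fun u => ⟪f n, κ u⟫) u₀ (u - u₀))
        + (fderiv ℝ (fun u => ⟪f n, κ u⟫) u₀ - L) (u - u₀) := by
    simp only [inner_sub_left, sub_apply]
    ring
  rw [key]
  have e4 := (fderiv ℝ (fun u => ⟪f n, κ u⟫) u₀ - L).le_opNorm (u - u₀)
  refine (norm_add₃_le).trans ?_
  have e5 := mul_le_mul_of_nonneg_right hn1.le (norm_nonneg (u - u₀))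
  have e6 := mul_le_mul_of_nonneg_right hn2.le (norm_nonneg (u - u₀))
  linarith

/-- The weak derivative at a point of Lipschitz continuity is represented by a vector. -/
theorem exists_fderiv_inner_eq_inner [CompleteSpace F] {κ : E → F} {u₀ : E}
    (h : (fun u => κ u - κ u₀) =O[𝓝 u₀] fun u => u - u₀)
    (hd : ∀ f, DifferentiableAt ℝ (fun u => ⟪f, κ u⟫) u₀) (e : E) :
    ∃ ξ : F, ∀ f, fderiv ℝ (fun u => ⟪f, κ u⟫) u₀ e = ⟪ξ, f⟫ := by
  obtain ⟨C, hC0, hC⟩ := h.exists_nonneg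
  have hC := hC.bound
  let T : F →ₗ[ℝ] ℝ :=
    { toFun := fun f => fderiv ℝ (fun u => ⟪f, κ u⟫) u₀ e
      map_add' := fun f g => by
        simp only [inner_add_left]
        rw [fderiv_fun_add (hd f) (hd g)]
        rfl
      map_smul' := fun c f => by
        simp only [real_inner_smul_left]
        rw [fderiv_const_mul (hd f)]
        rfl }
  let T' : F →L[ℝ] ℝ := T.mkContinuous (C * ‖e‖) fun f => by
    have h1 : ‖fderiv ℝ (fun u => ⟪f, κ u⟫) u₀‖ ≤ C * ‖f‖ := by
      refine (hd f).hasFDerivAt.le_of_lip' (by positivity) ?_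
      filter_upwards [hC] with u hu
      rw [← inner_sub_right]
      refine (norm_inner_le_norm _ _).trans ?_
      calc ‖f‖ * ‖κ u - κ u₀‖ ≤ ‖f‖ * (C * ‖u - u₀‖) := by gcongr
        _ = _ := by ring
    refine ((fderiv ℝ (fun u => ⟪f, κ u⟫) u₀).le_opNorm e).trans ?_
    calc _ ≤ C * ‖f‖ * ‖e‖ := by gcongr
      _ = _ := by ring
  refine ⟨(InnerProductSpace.toDual ℝ F).symm T', fun f => ?_⟩
  rw [InnerProductSpace.toDual_symm_apply]
  rfl

end WeakDerivative

/-! ### Derivative evaluations in the RKHS -/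

section Representer

variable {G : Type*} {H : Type*} [NormedAddCommGroup H] [InnerProductSpace ℝ H] [CompleteSpace H]
  [RKHS ℝ H G ℝ]

theorem inner_kerFun_one (h : H) (x : G) : ⟪h, RKHS.kerFun H x 1⟫ = h x := by
  simp

theorem kernelFn_eq_inner (x y : G) :
    kernelFn H x y = ⟪RKHS.kerFun H x 1, RKHS.kerFun H y 1⟫ := by
  rw [real_inner_comm, inner_kerFun_one, RKHS.kerFun_apply, kernelFn]

variable {E : Type*} [NormedAddCommGroup E] [NormedSpace ℝ E] [TopologicalSpace G]
  [ChartedSpace E G] [IsManifold 𝓘(ℝ, E) 2 G]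

/-- In a reproducing kernel Hilbert space with `C²` kernel, the functions are differentiable, and
the evaluations of their derivatives are represented by vectors. -/
theorem mdifferentiableAt_and_exists_mfderiv_eq_inner
    (hk : ContMDiff (𝓘(ℝ, E).prod 𝓘(ℝ, E)) 𝓘(ℝ, ℝ) 2 (fun z : G × G => kernelFn H z.1 z.2))
    (x : G) :
    (∀ h : H, MDifferentiableAt 𝓘(ℝ, E) 𝓘(ℝ, ℝ) (h : G → ℝ) x) ∧
    ∀ v : TangentSpace 𝓘(ℝ, E) x,
      ∃ ξ : H, ∀ h : H, mfderiv 𝓘(ℝ, E) 𝓘(ℝ, ℝ) (h : G → ℝ) x v = ⟪ξ, h⟫ := by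
  set φ := extChartAt 𝓘(ℝ, E) x with hφ
  set u₀ : E := φ x with hu₀
  let κ : E → H := fun u => RKHS.kerFun H (φ.symm u) 1
  have hsymm : ContMDiffAt 𝓘(ℝ, E) 𝓘(ℝ, E) 2 φ.symm u₀ :=
    (contMDiffOn_extChartAt_symm x).contMDiffAt (extChartAt_target_mem_nhds x)
  have hκ : ∀ (h : H) (u : E), ⟪h, κ u⟫ = h (φ.symm u) := fun h u => inner_kerFun_one _ _
  have hK : ContDiffAt ℝ 2 (fun z : E × E => ⟪κ z.1, κ z.2⟫) (u₀, u₀) := by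
    rw [← contMDiffAt_iff_contDiffAt]
    have h1 : ContMDiffAt 𝓘(ℝ, E × E) (𝓘(ℝ, E).prod 𝓘(ℝ, E)) 2
        (fun z : E × E => (φ.symm z.1, φ.symm z.2)) (u₀, u₀) := by
      refine ContMDiffAt.prodMk ?_ ?_
      · exact ContMDiffAt.comp (f := Prod.fst) (u₀, u₀) hsymm
          contDiffAt_fst.contMDiffAt
      · exact ContMDiffAt.comp (f := Prod.snd) (u₀, u₀) hsymm
          contDiffAt_snd.contMDiffAt
    have h2 := ContMDiffAt.comp (u₀, u₀) hk.contMDiffAt h1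
    refine h2.congr_of_eventuallyEq (Eventually.of_forall fun z => ?_)
    simp only [Function.comp, kernelFn_eq_inner, κ]
  have hO := isBigO_sub_of_contDiffAt_inner hK
  have hker : ∀ y : G, DifferentiableAt ℝ (fun u => ⟪RKHS.kerFun H y 1, κ u⟫) u₀ := by
    intro y
    have h1 : ContMDiffAt 𝓘(ℝ, E) (𝓘(ℝ, E).prod 𝓘(ℝ, E)) 2
        (fun u : E => (y, φ.symm u)) u₀ := contMDiffAt_const.prodMk hsymm
    have h2 := ContMDiffAt.comp u₀ hk.contMDiffAt h1
    refine (contMDiffAt_iff_contDiffAt.1 (h2.congr_of_eventuallyEq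
      (Eventually.of_forall fun z => ?_))).differentiableAt (by norm_num)
    simp only [Function.comp, kernelFn_eq_inner, κ]
  have hd : ∀ h : H, DifferentiableAt ℝ (fun u => ⟪h, κ u⟫) u₀ := by
    -- This subspace is closed and contains the kernel sections, whose span is dense, so it is all
    -- of `H`.
    let M : Submodule ℝ H :=
      { carrier := {f | DifferentiableAt ℝ (fun u => ⟪f, κ u⟫) u₀}
        add_mem' := fun {a b} ha hb => by
          simp only [Set.mem_ofPred_eq, inner_add_left] at *
          exact ha.add hb
        zero_mem' := by simp
        smul_mem' := fun c a ha => by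
          simp only [Set.mem_ofPred_eq, real_inner_smul_left] at *
          exact ha.const_mul c }
    have hle : (Submodule.span ℝ {RKHS.kerFun H y v | (y : G) (v : ℝ)}).topologicalClosure ≤ M := by
      refine Submodule.topologicalClosure_minimal _ (Submodule.span_le.2 ?_)
        (isClosed_setOf_differentiableAt_inner hO)
      rintro _ ⟨y, v, rfl⟩
      have : RKHS.kerFun H y v = v • RKHS.kerFun H y 1 := by
        rw [← map_smul, smul_eq_mul, mul_one]
      rw [this]
      exact M.smul_mem v (hker y)
    rw [RKHS.kerFun_dense] at hle
    exact fun h => hle (Submodule.mem_top (x := h))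
  have hd' : ∀ h : H, DifferentiableAt ℝ ((h : G → ℝ) ∘ φ.symm) u₀ := by
    intro h
    have := hd h
    simp only [hκ] at this
    exact this
  have hmd : ∀ h : H, MDifferentiableAt 𝓘(ℝ, E) 𝓘(ℝ, ℝ) (h : G → ℝ) x := by
    intro h
    rw [mdifferentiableAt_iff]
    refine ⟨?_, ?_⟩
    · have h1 : ContinuousAt (((h : G → ℝ) ∘ φ.symm) ∘ φ) x :=
        ContinuousAt.comp (hd' h).continuousAt (continuousAt_extChartAt x)
      refine h1.congr ?_
      filter_upwards [extChartAt_source_mem_nhds (I := 𝓘(ℝ, E)) x] with y hy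
      simp only [Function.comp]
      rw [φ.left_inv hy]
    · exact (hd' h).differentiableWithinAt
  refine ⟨hmd, fun v => ?_⟩
  obtain ⟨ξ, hξ⟩ := exists_fderiv_inner_eq_inner hO hd v
  refine ⟨ξ, fun h => ?_⟩
  rw [← hξ h, (hmd h).mfderiv]
  simp only [hκ]
  simp only [modelWithCornersSelf_coe, Set.range_id, fderivWithin_univ]
  rfl

end Representer

/-! ### The Stein kernel as a Gram kernel -/

section SteinFeature

variable {E : Type*} [NormedAddCommGroup E] [NormedSpace ℝ E] [FiniteDimensional ℝ E]
  {G : Type*} [TopologicalSpace G] [ChartedSpace E G] [Group G] [LieGroup 𝓘(ℝ, E) ∞ G]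
  {H : Type*} [NormedAddCommGroup H] [InnerProductSpace ℝ H] [CompleteSpace H] [RKHS ℝ H G ℝ]

/-- At a fixed `x` the score and the derivative of the modular function are mere scalars multiplying
point evaluation. -/
theorem exists_steinOp_eq_inner
    (hk : ContMDiff (𝓘(ℝ, E).prod 𝓘(ℝ, E)) 𝓘(ℝ, ℝ) 2 (fun z : G × G => kernelFn H z.1 z.2))
    (v : GroupLieAlgebra 𝓘(ℝ, E) G) (p : G → ℝ) (x : G) :
    ∃ ξ : H, ∀ h : H, steinOp v p h x = ⟪ξ, h⟫ := by
  have : IsManifold 𝓘(ℝ, E) 2 G := IsManifold.of_le (n := ∞) (by norm_cast)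
  obtain ⟨ξ, hξ⟩ :=
    (mdifferentiableAt_and_exists_mfderiv_eq_inner hk x).2 (mulInvariantVectorField v x)
  refine ⟨ξ + (score v p x + lieD v (modularFn E) x) • RKHS.kerFun H x 1, fun h => ?_⟩
  rw [inner_add_left, real_inner_smul_left, ← hξ h, real_inner_comm, inner_kerFun_one, steinOp]
  have key : ∀ a b c e : ℝ, a + b * c + b * e = a + (c + e) * b := fun a b c e => by ring
  exact key _ _ _ _

/-- The feature map of the Stein kernel. -/
theorem exists_stein_feature {d : ℕ} (b : Module.Basis (Fin d) ℝ (GroupLieAlgebra 𝓘(ℝ, E) G))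
    (hk : ContMDiff (𝓘(ℝ, E).prod 𝓘(ℝ, E)) 𝓘(ℝ, ℝ) 2 (fun z : G × G => kernelFn H z.1 z.2))
    (p : G → ℝ) :
    ∃ Φ : G → PiLp 2 (fun _ : Fin d => H),
      (∀ x f, steinOpVec b p f x = ⟪Φ x, f⟫) ∧ ∀ x y, steinKernel H b p x y = ⟪Φ x, Φ y⟫ := by
  choose ξ hξ using fun (l : Fin d) (x : G) => exists_steinOp_eq_inner hk (b l) p x
  refine ⟨fun x => WithLp.toLp 2 fun l => ξ l x, fun x f => ?_, fun x y => ?_⟩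
  · simp [steinOpVec, PiLp.inner_apply, hξ]
  · rw [steinKernel, PiLp.inner_apply]
    refine Finset.sum_congr rfl fun l _ => ?_
    -- Applied to the first argument of the kernel, the operator returns its own representer as a
    -- function of the second, to which it can be applied again.
    have h1 : (fun y' => steinOp (b l) p (fun x' => kernelFn H x' y') x) = ⇑(ξ l x) := by
      ext y'
      have h2 : (fun x' => kernelFn H x' y') = ⇑(RKHS.kerFun H y' 1) := by
        ext x'
        rw [RKHS.kerFun_apply, kernelFn]
      rw [h2, hξ, inner_kerFun_one]
    rw [h1, hξ, real_inner_comm]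

end SteinFeature

/-! ### Strong law and continuity via Gram kernels -/

section Preliminaries

theorem abs_norm_sq_sub_norm_sq_le {F : Type*} [SeminormedAddCommGroup F] {a b : F} {M δ : ℝ} (ha : ‖a‖ ≤ M) (hb : ‖b‖ ≤ M)
    (hab : ‖a - b‖ ≤ δ) : |‖a‖ ^ 2 - ‖b‖ ^ 2| ≤ δ * (2 * M) := by
  have h1 := abs_norm_sub_norm_le a b
  have e : ‖a‖ ^ 2 - ‖b‖ ^ 2 = (‖a‖ - ‖b‖) * (‖a‖ + ‖b‖) := by ring
  rw [e, abs_mul, abs_of_nonneg (by positivity : 0 ≤ ‖a‖ + ‖b‖)]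
  exact mul_le_mul (h1.trans hab) (by linarith) (by positivity) ((norm_nonneg _).trans hab)

/-- Integrability of a dominated map with continuous Gram kernel on a set carrying the measure. -/
theorem integrable_of_continuousOn_of_norm_le {G : Type*} [MeasurableSpace G] [TopologicalSpace G]
    [SecondCountableTopology G] [BorelSpace G] {ν : Measure G} {F : Type*} [NormedAddCommGroup F] {A : Set G} (hA : MeasurableSet A) (hνA : ν Aᶜ = 0)
    {ψ : G → F} (hψ : ContinuousOn ψ A) {s : G → ℝ} (hs : Integrable s ν)
    (hle : ∀ x, ‖ψ x‖ ≤ s x) : Integrable ψ ν := by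
  refine hs.mono' ?_ (Eventually.of_forall hle)
  have h := hψ.aestronglyMeasurable (μ := ν) hA
  rwa [Measure.restrict_eq_self_of_ae_mem] at h
  rw [ae_iff]
  exact hνA

/-- The strong law of large numbers for functions of an i.i.d. sample. -/
theorem ae_tendsto_sampleMean {B : Type*} [NormedAddCommGroup B] [NormedSpace ℝ B]
    [CompleteSpace B] {Ω : Type*} [MeasurableSpace Ω] {P : Measure Ω} {G : Type*} [MeasurableSpace G]
    {ν : Measure G} {X : ℕ → Ω → G} (hX : ∀ i, HasLaw (X i) ν P) (hind : iIndepFun X P) {f : G → B}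
    (hf : Integrable f ν) :
    ∀ᵐ ξ ∂P, Tendsto (fun n : ℕ => (n : ℝ)⁻¹ • ∑ i ∈ Finset.range n, f (X i ξ)) atTop
      (𝓝 (∫ x, f x ∂ν)) := by
  borelize B
  have hfm : ∀ i, AEMeasurable f (P.map (X i)) := fun i => by
    rw [(hX i).map_eq]; exact hf.aestronglyMeasurable.aemeasurable
  have hint : Integrable (f ∘ X 0) P := by
    refine Integrable.comp_aemeasurable ?_ (hX 0).aemeasurable
    rw [(hX 0).map_eq]; exact hf
  have h := strong_law_ae (fun i => f ∘ X i) hint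
    (fun i j hij => (hind.indepFun hij).comp₀ (hX i).aemeasurable (hX j).aemeasurable
      (hfm i) (hfm j))
    (fun i => IdentDistrib.comp_of_aemeasurable
      ⟨(hX i).aemeasurable, (hX 0).aemeasurable, by rw [(hX i).map_eq, (hX 0).map_eq]⟩ (hfm i))
  have he : ∫ ξ, (f ∘ X 0) ξ ∂P = ∫ x, f x ∂ν := by
    rw [← (hX 0).map_eq, integral_map (hX 0).aemeasurable]
    · rfl
    · rw [(hX 0).map_eq]; exact hf.aestronglyMeasurable
  rw [he] at h
  exact h

variable {F : Type*} [NormedAddCommGroup F] [InnerProductSpace ℝ F]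

theorem norm_sq_smul_sum {ι : Type*} (s : Finset ι) (c : ℝ) (v : ι → F) :
    ‖c • ∑ i ∈ s, v i‖ ^ 2 = c * ∑ j ∈ s, c * ∑ i ∈ s, ⟪v i, v j⟫ := by
  rw [← real_inner_self_eq_norm_sq, real_inner_smul_left, real_inner_smul_right, inner_sum]
  simp only [sum_inner, Finset.mul_sum]

/-- A map into an inner product space is continuous where its Gram kernel is continuous. -/
theorem continuousOn_of_continuousOn_inner {Z : Type*} [TopologicalSpace Z] {ψ : Z → F} {A : Set Z}
    (h : ContinuousOn (fun z : Z × Z => ⟪ψ z.1, ψ z.2⟫) (A ×ˢ A)) : ContinuousOn ψ A := by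
  intro x hx
  have h1 : ContinuousOn (fun z => ⟪ψ z, ψ z⟫) A :=
    h.comp (f := fun z => (z, z)) (by fun_prop) fun z hz => ⟨hz, hz⟩
  have h2 : ContinuousOn (fun z => ⟪ψ z, ψ x⟫) A :=
    h.comp (f := fun z => (z, x)) (by fun_prop) fun z hz => ⟨hz, hx⟩
  have h3 : Tendsto (fun z => ‖ψ z - ψ x‖ ^ 2) (𝓝[A] x) (𝓝 0) := by
    have h4 := ((h1 x hx).tendsto.sub ((h2 x hx).tendsto.const_mul 2)).add_const ⟪ψ x, ψ x⟫
    have e : (⟪ψ x, ψ x⟫ : ℝ) - 2 * ⟪ψ x, ψ x⟫ + ⟪ψ x, ψ x⟫ = 0 := by ring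
    rw [e] at h4
    refine h4.congr fun z => ?_
    rw [norm_sub_sq_real, real_inner_self_eq_norm_sq, real_inner_self_eq_norm_sq]
  rw [ContinuousWithinAt, tendsto_iff_norm_sub_tendsto_zero]
  have h5 := h3.sqrt
  simpa [Real.sqrt_sq] using h5

theorem continuousOn_of_continuousOn_gram {T G : Type*} [TopologicalSpace T] [TopologicalSpace G]
    {A : Set G} {Ψ : T → G → F}
    (hΨ : ContinuousOn (fun z : T × G × G => ⟪Ψ z.1 z.2.1, Ψ z.1 z.2.2⟫)
      {z | z.2.1 ∈ A ∧ z.2.2 ∈ A}) (t : T) : ContinuousOn (Ψ t) A :=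
  continuousOn_of_continuousOn_inner (hΨ.comp (f := fun z : G × G => (t, z.1, z.2))
    (by fun_prop) fun _ hz => hz)

end Preliminaries

/-! ### Uniform laws of large numbers -/

section SampleMeans

variable {Ω : Type*} [MeasurableSpace Ω] {P : Measure Ω}
  {G : Type*} [MeasurableSpace G] {ν : Measure G} {X : ℕ → Ω → G}

variable [TopologicalSpace G] [T2Space G] [BorelSpace G]
  [IsFiniteMeasure ν]

/-- A uniform strong law of large numbers: the functions are jointly continuous in the sample point
and the parameter, where the parameter space is compact and the functions are cut off outside a
compact set. -/
theorem ae_tendstoUniformly_sampleMean_indicator {Y : Type*} [TopologicalSpace Y] [CompactSpace Y]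
    (hX : ∀ i, HasLaw (X i) ν P) (hind : iIndepFun X P) {C : Set G} (hC : IsCompact C)
    (f : G → Y → ℝ) (hf : ContinuousOn (fun z : G × Y => f z.1 z.2) {z | z.1 ∈ C}) :
    (Continuous fun y => ∫ x in C, f x y ∂ν) ∧
    ∀ᵐ ξ ∂P, TendstoUniformly
      (fun (n : ℕ) y => (n : ℝ)⁻¹ * ∑ i ∈ Finset.range n, C.indicator (fun x => f x y) (X i ξ))
      (fun y => ∫ x in C, f x y ∂ν) atTop := by
  classical
  let f₀ : C(C × Y, ℝ) := ⟨fun z => f z.1 z.2, by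
    refine hf.comp_continuous (f := fun z : C × Y => ((z.1 : G), z.2)) (by fun_prop) ?_
    exact fun z => z.1.2⟩
  -- Norm convergence in `C(Y, ℝ)` is uniform convergence, so the Banach-valued strong law for `g`
  -- is the claim.
  let g : G → C(Y, ℝ) := fun x => if hx : x ∈ C then f₀.curry ⟨x, hx⟩ else 0
  have hg : ∀ x y, g x y = C.indicator (fun x => f x y) x := by
    intro x y
    by_cases hx : x ∈ C
    · simp [g, hx, f₀]
    · simp [g, hx]
  have hgC : ContinuousOn g C := by
    rw [continuousOn_iff_continuous_domRestrict]
    have : C.domRestrict g = f₀.curry := by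
      ext x : 1
      exact dif_pos x.2
    rw [this]
    exact f₀.curry.continuous
  have hgi : Integrable g ν := by
    refine (integrableOn_iff_integrable_of_support_subset (s := C) fun x hx => ?_).1
      (hgC.integrableOn_compact hC)
    by_contra hxC
    exact hx (by simp [g, hxC])
  have hint : ∀ y, (∫ x, g x ∂ν) y = ∫ x in C, f x y ∂ν := by
    intro y
    have h := (ContinuousMap.evalCLM ℝ y : C(Y, ℝ) →L[ℝ] ℝ).integral_comp_comm hgi
    simp only [ContinuousMap.evalCLM_apply, hg] at h
    rw [← h, integral_indicator hC.measurableSet]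
  constructor
  · have := (∫ x, g x ∂ν).continuous
    exact this.congr hint
  · filter_upwards [ae_tendsto_sampleMean hX hind hgi] with ξ hξ
    rw [ContinuousMap.tendsto_iff_tendstoUniformly] at hξ
    have e1 : (⇑(∫ x, g x ∂ν) : Y → ℝ) = fun y => ∫ x in C, f x y ∂ν := funext hint
    rw [e1] at hξ
    convert hξ using 3 with n y
    simp [hg]

variable {F : Type*} [NormedAddCommGroup F] [InnerProductSpace ℝ F] [CompleteSpace F]

variable {T : Type*} [TopologicalSpace T]

variable [CompactSpace T]

/-- Uniform convergence of the squared norms of the sample means of a family of maps with continuous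
Gram kernels, cut off outside a compact set. -/
theorem ae_tendstoUniformly_norm_sampleMean_indicator_sq
    (hX : ∀ i, HasLaw (X i) ν P) (hind : iIndepFun X P) {C : Set G} (hC : IsCompact C)
    {Ψ : T → G → F}
    (hΨ : ContinuousOn (fun z : T × G × G => ⟪Ψ z.1 z.2.1, Ψ z.1 z.2.2⟫)
      {z | z.2.1 ∈ C ∧ z.2.2 ∈ C}) :
    ∀ᵐ ξ ∂P, TendstoUniformly
      (fun (n : ℕ) t => ‖(n : ℝ)⁻¹ • ∑ i ∈ Finset.range n, C.indicator (Ψ t) (X i ξ)‖ ^ 2)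
      (fun t => ‖∫ x in C, Ψ t x ∂ν‖ ^ 2) atTop := by
  have : CompactSpace C := isCompact_iff_compactSpace.1 hC
  have hΨt : ∀ t, IntegrableOn (Ψ t) C ν := fun t =>
    (continuousOn_of_continuousOn_gram hΨ t).integrableOn_compact hC
  -- The second kernel argument joins the parameters: uniformity over `C` lets the random point `X j
  -- ξ` be substituted for it later.
  obtain ⟨hg, h1⟩ := ae_tendstoUniformly_sampleMean_indicator (P := P) hX hind hC
    (fun x (z : T × C) => ⟪Ψ z.1 x, Ψ z.1 z.2⟫)
    (hΨ.comp (f := fun z : G × T × C => (z.2.1, z.1, (z.2.2 : G))) (by fun_prop)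
      fun z hz => ⟨hz, z.2.2.2⟩)
  -- The limit of the inner means is itself averaged over the sample.
  obtain ⟨-, h2⟩ := ae_tendstoUniformly_sampleMean_indicator (P := P) hX hind hC
    (fun y t => ∫ x in C, ⟪Ψ t x, Ψ t y⟫ ∂ν) (by
      rw [continuousOn_iff_continuous_domRestrict]
      exact hg.comp (f := fun z : {z : G × T | z.1 ∈ C} => (z.1.2, (⟨z.1.1, z.2⟩ : C)))
        (by fun_prop))
  filter_upwards [h1, h2] with ξ h1 h2
  rw [Metric.tendstoUniformly_iff] at *
  intro ε hε
  filter_upwards [h1 (ε / 2) (by positivity), h2 (ε / 2) (by positivity)] with n h1 h2 t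
  have e1 : ∫ y in C, ∫ x in C, ⟪Ψ t x, Ψ t y⟫ ∂ν ∂ν = ‖∫ x in C, Ψ t x ∂ν‖ ^ 2 := by
    rw [← real_inner_self_eq_norm_sq, ← integral_inner (hΨt t)]
    refine integral_congr_ae (Eventually.of_forall fun y => ?_)
    simp only
    rw [real_inner_comm, ← integral_inner (hΨt t)]
    refine integral_congr_ae (Eventually.of_forall fun x => ?_)
    simp only
    rw [real_inner_comm]
  have h2' := h2 t
  simp only [e1] at h2'
  rw [norm_sq_smul_sum]
  set S := Finset.range n
  have h3 : dist ((n : ℝ)⁻¹ * ∑ j ∈ S, C.indicator (fun y => ∫ x in C, ⟪Ψ t x, Ψ t y⟫ ∂ν) (X j ξ))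
      ((n : ℝ)⁻¹ * ∑ j ∈ S, (n : ℝ)⁻¹ * ∑ i ∈ S,
        ⟪C.indicator (Ψ t) (X i ξ), C.indicator (Ψ t) (X j ξ)⟫) ≤ ε / 2 := by
    have h4 : ∀ j, |C.indicator (fun y => ∫ x in C, ⟪Ψ t x, Ψ t y⟫ ∂ν) (X j ξ)
        - (n : ℝ)⁻¹ * ∑ i ∈ S, ⟪C.indicator (Ψ t) (X i ξ), C.indicator (Ψ t) (X j ξ)⟫| ≤ ε / 2 := by
      intro j
      by_cases hj : X j ξ ∈ C
      · have h5 := (h1 (t, ⟨X j ξ, hj⟩)).le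
        rw [Real.dist_eq] at h5
        rw [Set.indicator_of_mem hj, Set.indicator_of_mem hj]
        have e : ∀ i, (⟪C.indicator (Ψ t) (X i ξ), Ψ t (X j ξ)⟫ : ℝ)
            = C.indicator (fun x => ⟪Ψ t x, Ψ t (X j ξ)⟫) (X i ξ) := by
          intro i
          by_cases hi : X i ξ ∈ C
          · rw [Set.indicator_of_mem hi, Set.indicator_of_mem hi]
          · rw [Set.indicator_of_notMem hi, Set.indicator_of_notMem hi, inner_zero_left]
        simp only [e]
        exact h5
      · simp [hj]; positivity
    rw [Real.dist_eq, ← mul_sub, ← Finset.sum_sub_distrib, abs_mul,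
      abs_of_nonneg (by positivity : (0 : ℝ) ≤ (n : ℝ)⁻¹)]
    have h6 : |∑ j ∈ S, (C.indicator (fun y => ∫ x in C, ⟪Ψ t x, Ψ t y⟫ ∂ν) (X j ξ)
        - (n : ℝ)⁻¹ * ∑ i ∈ S, ⟪C.indicator (Ψ t) (X i ξ), C.indicator (Ψ t) (X j ξ)⟫)|
        ≤ n * (ε / 2) := by
      refine (Finset.abs_sum_le_sum_abs _ _).trans ((Finset.sum_le_sum fun j _ => h4 j).trans ?_)
      simp [S]
    calc _ ≤ (n : ℝ)⁻¹ * (n * (ε / 2)) := by gcongr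
      _ ≤ ε / 2 := by
        rcases eq_or_ne (n : ℝ) 0 with h0 | h0
        · rw [h0]; simp; positivity
        · rw [inv_mul_cancel_left₀ h0]
  have := dist_triangle (‖∫ x in C, Ψ t x ∂ν‖ ^ 2) _ _ |>.trans_lt (add_lt_add_of_lt_of_le h2' h3)
  linarith

variable [SecondCountableTopology G] [LocallyCompactSpace G]

/-- A set carrying the measure contains compact sets off which the integral of a given integrable
function is small. -/
theorem exists_isCompact_setIntegral_compl_lt {A : Set G} (hA : MeasurableSet A) (hνA : ν Aᶜ = 0)
    {s : G → ℝ} (hs : Integrable s ν) (hs0 : ∀ x, 0 ≤ s x) {ε : ℝ} (hε : 0 < ε) :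
    ∃ C ⊆ A, IsCompact C ∧ ∫ x in Cᶜ, s x ∂ν < ε := by
  -- A metric yields inner regularity of the finite measure; absolute continuity of the integral
  -- does the rest.
  have : TopologicalSpace.MetrizableSpace G :=
    TopologicalSpace.metrizableSpace_of_t3_secondCountable G
  let _ := TopologicalSpace.metrizableSpaceMetric G
  obtain ⟨δ, hδ, h⟩ := exists_pos_setLIntegral_lt_of_measure_lt (μ := ν)
    (f := fun x => ENNReal.ofReal (s x)) (by
      rw [← ofReal_integral_eq_lintegral_ofReal hs (Eventually.of_forall hs0)]
      exact ENNReal.ofReal_ne_top) (ε := ENNReal.ofReal ε) (by simpa using hε)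
  obtain ⟨C, hCA, hC, hlt⟩ := hA.exists_isCompact_sdiff_lt (μ := ν) (measure_ne_top _ _) hδ.ne'
  refine ⟨C, hCA, hC, ?_⟩
  have hCc : ν Cᶜ < δ := by
    refine lt_of_le_of_lt ?_ hlt
    calc ν Cᶜ ≤ ν (A \ C ∪ Aᶜ) := measure_mono fun x hx => by
          by_cases hxA : x ∈ A
          · exact Or.inl ⟨hxA, hx⟩
          · exact Or.inr hxA
      _ ≤ ν (A \ C) + ν Aᶜ := measure_union_le _ _
      _ = ν (A \ C) := by rw [hνA, add_zero]
  have h1 := h _ hCc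
  rw [← ofReal_integral_eq_lintegral_ofReal hs.integrableOn (Eventually.of_forall hs0)] at h1
  exact (ENNReal.ofReal_lt_ofReal_iff hε).1 h1

/-- Uniform convergence of the squared norms of the sample means of a dominated family of maps with
continuous Gram kernels. -/
theorem ae_tendstoUniformly_norm_sampleMean_sq
    (hX : ∀ i, HasLaw (X i) ν P) (hind : iIndepFun X P) {A : Set G} (hA : MeasurableSet A)
    (hνA : ν Aᶜ = 0) {Ψ : T → G → F}
    (hΨ : ContinuousOn (fun z : T × G × G => ⟪Ψ z.1 z.2.1, Ψ z.1 z.2.2⟫)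
      {z | z.2.1 ∈ A ∧ z.2.2 ∈ A})
    {s : G → ℝ} (hs : Integrable s ν) (hs0 : ∀ x, 0 ≤ s x) (hle : ∀ t x, ‖Ψ t x‖ ≤ s x) :
    ∀ᵐ ξ ∂P, TendstoUniformly
      (fun (n : ℕ) t => ‖(n : ℝ)⁻¹ • ∑ i ∈ Finset.range n, Ψ t (X i ξ)‖ ^ 2)
      (fun t => ‖∫ x, Ψ t x ∂ν‖ ^ 2) atTop := by
  -- Countably many cut-offs are fixed in advance, so that one null set serves every `ε`.
  choose C hCA hC hCs using fun m : ℕ => exists_isCompact_setIntegral_compl_lt hA hνA hs hs0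
    (Nat.one_div_pos_of_nat (α := ℝ) (n := m))
  have hΨi : ∀ t, Integrable (Ψ t) ν := fun t =>
    integrable_of_continuousOn_of_norm_le hA hνA (continuousOn_of_continuousOn_gram hΨ t) hs (hle t)
  have h1 : ∀ᵐ ξ ∂P, ∀ m, TendstoUniformly
      (fun (n : ℕ) t => ‖(n : ℝ)⁻¹ • ∑ i ∈ Finset.range n, (C m).indicator (Ψ t) (X i ξ)‖ ^ 2)
      (fun t => ‖∫ x in C m, Ψ t x ∂ν‖ ^ 2) atTop :=
    ae_all_iff.2 fun m => ae_tendstoUniformly_norm_sampleMean_indicator_sq hX hind (hC m)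
      (hΨ.mono fun z hz => ⟨hCA m hz.1, hCA m hz.2⟩)
  have h2 : ∀ᵐ ξ ∂P, ∀ m, Tendsto
      (fun n : ℕ => (n : ℝ)⁻¹ • ∑ i ∈ Finset.range n, (C m)ᶜ.indicator s (X i ξ)) atTop
      (𝓝 (∫ x, (C m)ᶜ.indicator s x ∂ν)) :=
    ae_all_iff.2 fun m => ae_tendsto_sampleMean hX hind
      (hs.indicator (hC m).measurableSet.compl)
  filter_upwards [h1, h2, ae_tendsto_sampleMean hX hind hs] with ξ h1 h2 h3
  rw [Metric.tendstoUniformly_iff]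
  intro ε hε
  set M : ℝ := ∫ x, s x ∂ν + 1 with hM
  have hM0 : 0 < M := by
    have : 0 ≤ ∫ x, s x ∂ν := integral_nonneg hs0
    positivity
  -- `M` eventually bounds all means involved, so cutting off changes each squared norm by at most
  -- `δ * (2 * M) < ε / 3`.
  obtain ⟨m, hm⟩ := exists_nat_one_div_lt (show 0 < ε / 3 / (2 * M) by positivity)
  rw [lt_div_iff₀ (by positivity)] at hm
  set δ : ℝ := 1 / ((m : ℝ) + 1)
  have hCm := hCs m
  have h2m := h2 m
  rw [integral_indicator (hC m).measurableSet.compl] at h2m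
  filter_upwards [Metric.tendstoUniformly_iff.1 (h1 m) (ε / 3) (by positivity),
    h2m.eventually_lt_const hCm, h3.eventually_lt_const (show ∫ x, s x ∂ν < M by linarith)]
    with n h1 h2 h3 t
  have hn : (0 : ℝ) ≤ (n : ℝ)⁻¹ := by positivity
  have hsum : ∀ (v : G → F) (r : G → ℝ), (∀ x, ‖v x‖ ≤ r x) →
      ‖(n : ℝ)⁻¹ • ∑ i ∈ Finset.range n, v (X i ξ)‖
        ≤ (n : ℝ)⁻¹ • ∑ i ∈ Finset.range n, r (X i ξ) := by
    intro v r hvr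
    rw [norm_smul, Real.norm_of_nonneg hn, smul_eq_mul]
    gcongr
    exact norm_sum_le_of_le _ fun i _ => hvr _
  have hind_le : ∀ x, ‖(C m).indicator (Ψ t) x‖ ≤ s x := fun x =>
    (norm_indicator_le_norm_self _ _).trans (hle t x)
  have hcompl : ∀ x, ‖Ψ t x - (C m).indicator (Ψ t) x‖ ≤ (C m)ᶜ.indicator s x := by
    intro x
    by_cases hx : x ∈ C m
    · simp [hx]
    · simp [hx, hle t x]
  have d1 := abs_norm_sq_sub_norm_sq_le ((hsum _ _ (hle t)).trans h3.le)
    ((hsum _ _ hind_le).trans h3.le) (δ := δ) (by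
      rw [← smul_sub, ← Finset.sum_sub_distrib]
      exact (hsum _ _ hcompl).trans h2.le)
  have d2 := abs_norm_sq_sub_norm_sq_le (a := ∫ x, Ψ t x ∂ν) (b := ∫ x in C m, Ψ t x ∂ν)
    (M := M) (δ := δ)
    ((norm_integral_le_of_norm_le hs (Eventually.of_forall (hle t))).trans (by linarith))
    ((norm_integral_le_of_norm_le hs.integrableOn (Eventually.of_forall (hle t))).trans
      ((setIntegral_le_integral hs (Eventually.of_forall hs0)).trans (by linarith)))
    (by
      rw [← integral_add_compl (hC m).measurableSet (hΨi t), add_sub_cancel_left]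
      exact (norm_integral_le_of_norm_le hs.integrableOn (Eventually.of_forall (hle t))).trans
        hCm.le)
  have d3 := h1 t
  rw [Real.dist_eq] at d3 ⊢
  rw [abs_le] at d1 d2
  rw [abs_lt] at d3 ⊢
  constructor <;> linarith [d1.1, d1.2, d2.1, d2.2, d3.1, d3.2]

end SampleMeans

theorem sSup_inner_closedBall_eq_norm {F : Type*} [NormedAddCommGroup F] [InnerProductSpace ℝ F]
    (m : F) :
    BddAbove {r : ℝ | ∃ f : F, ‖f‖ ≤ 1 ∧ r = ⟪m, f⟫} ∧
      sSup {r : ℝ | ∃ f : F, ‖f‖ ≤ 1 ∧ r = ⟪m, f⟫} = ‖m‖ := by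
  have hub : ∀ r ∈ {r : ℝ | ∃ f : F, ‖f‖ ≤ 1 ∧ r = ⟪m, f⟫}, r ≤ ‖m‖ := by
    rintro _ ⟨f, hf, rfl⟩
    exact (real_inner_le_norm m f).trans (mul_le_of_le_one_right (norm_nonneg _) hf)
  refine ⟨⟨‖m‖, hub⟩, ?_⟩
  -- For `m = 0` the inverse is `0` and the witness is the zero vector.
  refine IsGreatest.csSup_eq ⟨⟨‖m‖⁻¹ • m, ?_, ?_⟩, hub⟩
  · rw [norm_smul, norm_inv, norm_norm]
    exact inv_mul_le_one
  · rw [real_inner_smul_right, real_inner_self_eq_norm_sq]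
    rcases eq_or_ne ‖m‖ 0 with h | h
    · rw [h]; simp
    · field_simp

/-! ### Integration against a density -/

section Density

variable {G : Type*} [MeasurableSpace G] {μ : Measure G} {w : G → ℝ}

theorem IsProbDensity.isProbabilityMeasure_distr (hw : IsProbDensity μ w) :
    IsProbabilityMeasure (distr μ w) :=
  ⟨by rw [distr, withDensity_apply _ MeasurableSet.univ, Measure.restrict_univ,
    hw.lintegral_eq_one]⟩

theorem IsProbDensity.measurableSet_pos (hw : IsProbDensity μ w) : MeasurableSet {x | 0 < w x} :=
  measurableSet_lt measurable_const hw.measurable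

theorem IsProbDensity.distr_compl_pos (hw : IsProbDensity μ w) : distr μ w {x | 0 < w x}ᶜ = 0 := by
  rw [distr, withDensity_apply _ hw.measurableSet_pos.compl]
  refine (setLIntegral_eq_zero_iff hw.measurableSet_pos.compl hw.measurable.ennreal_ofReal).2
    (Eventually.of_forall fun x hx => ?_)
  exact ENNReal.ofReal_eq_zero.2 (not_lt.1 hx)

theorem IsProbDensity.integrable_distr_iff (hw : IsProbDensity μ w) {f : G → ℝ} :
    Integrable f (distr μ w) ↔ Integrable (fun x => w x * f x) μ := by
  have h := integrable_withDensity_iff_integrable_smul (μ := μ) hw.measurable.real_toNNReal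
    (g := f)
  have e : (fun x => (w x).toNNReal • f x) = fun x => w x * f x := by
    ext x
    rw [NNReal.smul_def, Real.coe_toNNReal _ (hw.nonneg x), smul_eq_mul]
  rw [e] at h
  exact h

theorem IsProbDensity.integral_distr (hw : IsProbDensity μ w) (f : G → ℝ) :
    ∫ x, f x ∂(distr μ w) = ∫ x, w x * f x ∂μ := by
  have h := integral_withDensity_eq_integral_smul (μ := μ) hw.measurable.real_toNNReal f
  have e : ∀ x, (w x).toNNReal • f x = w x * f x := by
    intro x
    rw [NNReal.smul_def, Real.coe_toNNReal _ (hw.nonneg x), smul_eq_mul]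
  simp only [e] at h
  exact h

end Density

/-! ### Discrepancies as norms of means -/

section WeightedFeature

variable {E : Type*} [NormedAddCommGroup E] [NormedSpace ℝ E] [FiniteDimensional ℝ E]
  {G : Type*} [TopologicalSpace G] [ChartedSpace E G] [Group G] [LieGroup 𝓘(ℝ, E) ∞ G]
  {H : Type*} [NormedAddCommGroup H] [InnerProductSpace ℝ H] [CompleteSpace H] [RKHS ℝ H G ℝ]
  {d : ℕ} (b : Module.Basis (Fin d) ℝ (GroupLieAlgebra 𝓘(ℝ, E) G))

/-- The feature map of the weighted Stein kernel. -/
theorem exists_weighted_feature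
    (hk : ContMDiff (𝓘(ℝ, E).prod 𝓘(ℝ, E)) 𝓘(ℝ, ℝ) 2 (fun z : G × G => kernelFn H z.1 z.2))
    (p q w : G → ℝ) :
    ∃ Ψ : G → PiLp 2 (fun _ : Fin d => H),
      (∀ x f, w x ≠ 0 → w x * ⟪Ψ x, f⟫ = steinOpVec b p f x * q x) ∧
      (∀ x, w x = 0 → Ψ x = 0) ∧ ∀ x y, weightedKernel H b p q w x y = ⟪Ψ x, Ψ y⟫ := by
  obtain ⟨Φ, h1, h2⟩ := exists_stein_feature b hk p
  refine ⟨fun x => (q x * (w x)⁻¹) • Φ x, fun x f hx => ?_, fun x hx => ?_, fun x y => ?_⟩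
  · rw [real_inner_smul_left, h1]
    field_simp
  · simp [hx]
  · rw [real_inner_smul_left, real_inner_smul_right, weightedKernel, h2]
    ring

variable [MeasurableSpace G] {μ : Measure G} {p q w : G → ℝ}
  {Ψ : G → PiLp 2 (fun _ : Fin d => H)}

/-- The expectations of the Stein operator are represented by the mean of the weighted feature map;
its norm is the discrepancy. -/
theorem ksd_eq_norm_integral (hw : IsProbDensity μ w) (hqw : ∀ᵐ x ∂μ, w x = 0 → q x = 0)
    (h : ∀ x f, w x ≠ 0 → w x * ⟪Ψ x, f⟫ = steinOpVec b p f x * q x)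
    (hΨ : Integrable Ψ (distr μ w)) :
    (∀ f : PiLp 2 (fun _ : Fin d => H), Integrable (fun x => steinOpVec b p f x * q x) μ) ∧
    BddAbove {r : ℝ | ∃ f : PiLp 2 (fun _ : Fin d => H), ‖f‖ ≤ 1 ∧
      r = ∫ x, steinOpVec b p f x * q x ∂μ} ∧
    ksd H b μ p q = ‖∫ x, Ψ x ∂(distr μ w)‖ := by
  -- Where `w` vanishes, so does `q` almost everywhere; hence reweighting loses nothing.
  have hae : ∀ f : PiLp 2 (fun _ : Fin d => H),
      (fun x => w x * ⟪Ψ x, f⟫) =ᵐ[μ] fun x => steinOpVec b p f x * q x := by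
    intro f
    filter_upwards [hqw] with x hx
    by_cases hwx : w x = 0
    · rw [hx hwx, hwx]; ring
    · exact h x f hwx
  have hint : ∀ f : PiLp 2 (fun _ : Fin d => H),
      ∫ x, steinOpVec b p f x * q x ∂μ = ⟪∫ x, Ψ x ∂(distr μ w), f⟫ := by
    intro f
    rw [← integral_congr_ae (hae f), ← hw.integral_distr, real_inner_comm, ← integral_inner hΨ]
    simp only [real_inner_comm]
  refine ⟨fun f => ?_, ?_⟩
  · refine (hw.integrable_distr_iff.1 ?_).congr (hae f)
    exact hΨ.inner_const f
  · rw [ksd]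
    simp only [hint]
    exact sSup_inner_closedBall_eq_norm _

end WeightedFeature

theorem wksdSq_eq_norm_sq {E : Type*} [NormedAddCommGroup E] [NormedSpace ℝ E]
    [FiniteDimensional ℝ E] {G : Type*} [TopologicalSpace G] [ChartedSpace E G] [Group G]
    [LieGroup 𝓘(ℝ, E) ∞ G] {H : Type*} [NormedAddCommGroup H] [InnerProductSpace ℝ H]
    [CompleteSpace H] [RKHS ℝ H G ℝ] {d : ℕ}
    (b : Module.Basis (Fin d) ℝ (GroupLieAlgebra 𝓘(ℝ, E) G)) {p q w : G → ℝ} {F : Type*}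
    [NormedAddCommGroup F] [InnerProductSpace ℝ F] {Ψ : G → F}
    (h : ∀ x y, weightedKernel H b p q w x y = ⟪Ψ x, Ψ y⟫) (n : ℕ) (x : ℕ → G) :
    wksdSq H b p q w n x = ‖(n : ℝ)⁻¹ • ∑ i ∈ Finset.range n, Ψ (x i)‖ ^ 2 := by
  rw [norm_sq_smul_sum, wksdSq, Finset.sum_comm]
  simp only [h, Finset.mul_sum]
  refine Finset.sum_congr rfl fun j _ => Finset.sum_congr rfl fun i _ => ?_
  ring


end LieKSD

/-! ### The main theorem -/

theorem theorem4p2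
    -- a connected Lie group `G` with a left-invariant basis and a left Haar measure
    {E : Type*} [NormedAddCommGroup E] [NormedSpace ℝ E] [FiniteDimensional ℝ E]
    {G : Type*} [TopologicalSpace G] [T2Space G] [SecondCountableTopology G] [ConnectedSpace G]
    [ChartedSpace E G] [Group G] [LieGroup 𝓘(ℝ, E) ∞ G]
    {d : ℕ} (b : Module.Basis (Fin d) ℝ (GroupLieAlgebra 𝓘(ℝ, E) G))
    [MeasurableSpace G] [BorelSpace G] (μ : Measure G) [μ.IsHaarMeasure]
    -- a reproducing kernel Hilbert space on `G` with a `C²` kernel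
    (H : Type*) [NormedAddCommGroup H] [InnerProductSpace ℝ H] [CompleteSpace H] [RKHS ℝ H G ℝ]
    (hk : ContMDiff (𝓘(ℝ, E).prod 𝓘(ℝ, E)) 𝓘(ℝ, ℝ) 2
      (fun z : G × G => LieKSD.kernelFn H z.1 z.2))
    -- the target density, the model densities, and the sampling density
    {Θ : Type*} [MetricSpace Θ]
    (q : G → ℝ) (hq : LieKSD.IsProbDensity μ q) (hqL : LieKSD.LocLipschitz E q)
    (p : Θ → G → ℝ) (hp : ∀ θ, LieKSD.IsProbDensity μ (p θ))
    (hpL : ∀ θ, LieKSD.LocLipschitz E (p θ))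
    (w : G → ℝ) (hw : LieKSD.IsProbDensity μ w)
    (hqw : ∀ᵐ x ∂μ, w x = 0 → q x = 0)
    -- an i.i.d. sample from `w`
    {Ω : Type*} [MeasurableSpace Ω] (P : Measure Ω) [IsProbabilityMeasure P]
    (X : ℕ → Ω → G) (hX : ∀ i, HasLaw (X i) (LieKSD.distr μ w) P) (hind : iIndepFun X P)
    -- joint continuity of `V` and integrability of the suprema of `V` over compact sets
    (hVcont : ContinuousOn
      (fun z : Θ × G × G => LieKSD.weightedKernel H b (p z.1) q w z.2.1 z.2.2)
      {z | 0 < w z.2.1 ∧ 0 < w z.2.2})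
    (hVint : ∀ K : Set Θ, IsCompact K → Integrable
      (fun x => ⨆ θ : K, LieKSD.weightedKernel H b (p θ) q w x x) (LieKSD.distr μ w)) :
    -- `KSD` is a supremum of a bounded set of honest expectations
    (∀ θ, (∀ f : PiLp 2 (fun _ : Fin d => H),
        Integrable (fun x => LieKSD.steinOpVec b (p θ) f x * q x) μ) ∧
      BddAbove {r : ℝ | ∃ f : PiLp 2 (fun _ : Fin d => H), ‖f‖ ≤ 1 ∧
        r = ∫ x, LieKSD.steinOpVec b (p θ) f x * q x ∂μ}) ∧
    -- locally uniform convergence, almost surely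
    (∀ K : Set Θ, IsCompact K → ∀ᵐ ξ ∂P, TendstoUniformlyOn
      (fun (n : ℕ) (θ : Θ) => LieKSD.wksdSq H b (p θ) q w n (fun i => X i ξ))
      (fun θ => LieKSD.ksd H b μ (p θ) q ^ 2) atTop K) ∧
    -- continuity
    (LocallyCompactSpace Θ →
      (∀ (n : ℕ) (ξ : Ω), Continuous
        (fun θ => LieKSD.wksd H b (p θ) q w n (fun i => X i ξ))) ∧
      Continuous (fun θ => LieKSD.ksd H b μ (p θ) q)) := by
  have : LocallyCompactSpace G := Manifold.locallyCompact_of_finiteDimensional 𝓘(ℝ, E)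
  have := hw.isProbabilityMeasure_distr
  set ν := LieKSD.distr μ w with hν
  set A : Set G := {x | 0 < w x} with hAdef
  have hA : MeasurableSet A := hw.measurableSet_pos
  have hνA : ν Aᶜ = 0 := hw.distr_compl_pos
  choose Ψ hΨ1 hΨ0 hΨ using fun θ => LieKSD.exists_weighted_feature b hk (p θ) q w
  have hw0 : ∀ x, x ∉ A → w x = 0 := fun x hx => le_antisymm (not_lt.1 hx) (hw.nonneg x)
  have hcont : ContinuousOn (fun z : Θ × G × G => (inner ℝ (Ψ z.1 z.2.1) (Ψ z.1 z.2.2) : ℝ))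
      {z | z.2.1 ∈ A ∧ z.2.2 ∈ A} := by
    simp only [hΨ] at hVcont
    exact hVcont
  -- the envelope of the feature maps over a compact parameter set
  have henv : ∀ K : Set Θ, IsCompact K → ∃ s : G → ℝ, Integrable s ν ∧ (∀ x, 0 ≤ s x) ∧
      ∀ θ ∈ K, ∀ x, ‖Ψ θ x‖ ≤ s x := by
    intro K hK
    set S : G → ℝ := fun x => ⨆ θ : K, LieKSD.weightedKernel H b (p θ) q w x x
    have hS : Integrable S ν := hVint K hK
    refine ⟨fun x => √(S x), ?_, fun x => Real.sqrt_nonneg _, fun θ hθ x => ?_⟩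
    -- `√a ≤ |a| + 1`, and constants are integrable for a probability measure.
    · refine (hS.norm.add (integrable_const 1)).mono'
        (Real.continuous_sqrt.comp_aestronglyMeasurable hS.aestronglyMeasurable)
        (Eventually.of_forall fun x => ?_)
      rw [Real.norm_of_nonneg (Real.sqrt_nonneg _), Pi.add_apply]
      refine (Real.sqrt_le_sqrt (Real.le_norm_self (S x))).trans ?_
      rw [Real.sqrt_le_left (by positivity)]
      nlinarith [norm_nonneg (S x)]
    · by_cases hx : x ∈ A
      · refine Real.le_sqrt_of_sq_le ?_
        rw [← real_inner_self_eq_norm_sq, ← hΨ]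
        -- The real supremum is meaningful only if bounded, which continuity on the compact `K`
        -- ensures.
        refine le_ciSup (f := fun θ : K => LieKSD.weightedKernel H b (p θ) q w x x) ?_ ⟨θ, hθ⟩
        have hc : ContinuousOn (fun θ => LieKSD.weightedKernel H b (p θ) q w x x) K :=
          (hVcont.comp (f := fun θ => (θ, x, x)) (s := Set.univ) (by fun_prop)
            fun _ _ => ⟨hx, hx⟩).mono (Set.subset_univ _)
        have := (hK.image_of_continuousOn hc).bddAbove
        rwa [Set.image_eq_range] at this
      · rw [hΨ0 θ x (hw0 x hx), norm_zero]
        exact Real.sqrt_nonneg _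
  have hΨi : ∀ θ, Integrable (Ψ θ) ν := fun θ => by
    obtain ⟨s, hs, -, hle⟩ := henv {θ} isCompact_singleton
    exact LieKSD.integrable_of_continuousOn_of_norm_le hA hνA
      (LieKSD.continuousOn_of_continuousOn_gram hcont θ) hs (hle θ rfl)
  have hksd := fun θ => LieKSD.ksd_eq_norm_integral b hw hqw (hΨ1 θ) (hΨi θ)
  have hconv : ∀ K : Set Θ, IsCompact K → ∀ᵐ ξ ∂P, TendstoUniformlyOn
      (fun (n : ℕ) (θ : Θ) => LieKSD.wksdSq H b (p θ) q w n (fun i => X i ξ))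
      (fun θ => LieKSD.ksd H b μ (p θ) q ^ 2) atTop K := by
    intro K hK
    have : CompactSpace K := isCompact_iff_compactSpace.1 hK
    obtain ⟨s, hs, hs0, hle⟩ := henv K hK
    filter_upwards [LieKSD.ae_tendstoUniformly_norm_sampleMean_sq (T := K)
      (Ψ := fun θ x => Ψ θ x) hX hind hA hνA
      (hcont.comp (f := fun z : K × G × G => ((z.1 : Θ), z.2)) (by fun_prop) fun z hz => hz)
      hs hs0 (fun θ x => hle θ θ.2 x)] with ξ hξ
    rw [tendstoUniformlyOn_iff_tendstoUniformly_comp_coe]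
    simp only [LieKSD.wksdSq_eq_norm_sq b (hΨ _), fun θ => (hksd θ).2.2]
    exact hξ
  have hwc : ∀ (n : ℕ) (x : ℕ → G), Continuous fun θ => LieKSD.wksdSq H b (p θ) q w n x := by
    intro n x
    unfold LieKSD.wksdSq
    refine continuous_const.mul (continuous_finsetSum _ fun i _ =>
      continuous_finsetSum _ fun j _ => ?_)
    -- Continuity is given only on `A`; elsewhere the feature map is zero, so every realization is
    -- covered.
    by_cases hi : x i ∈ A
    · by_cases hj : x j ∈ A
      · exact hVcont.comp_continuous (f := fun θ => (θ, x i, x j)) (by fun_prop)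
          fun _ => ⟨hi, hj⟩
      · simp only [hΨ, hΨ0 _ _ (hw0 _ hj), inner_zero_right]
        exact continuous_const
    · simp only [hΨ, hΨ0 _ _ (hw0 _ hi), inner_zero_left]
      exact continuous_const
  refine ⟨fun θ => ⟨(hksd θ).1, (hksd θ).2.1⟩, hconv, fun hΘ => ⟨fun n ξ => (hwc n _).sqrt, ?_⟩⟩
  have hsq : Continuous fun θ => LieKSD.ksd H b μ (p θ) q ^ 2 := by
    rw [continuous_iff_continuousAt]
    intro θ
    obtain ⟨K, hK, hKθ⟩ := exists_compact_mem_nhds θ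
    -- An almost sure event is nonempty, and a single good realization exhibits `KSD²` as a uniform
    -- limit of continuous functions near `θ`.
    obtain ⟨ξ, hξ⟩ := (hconv K hK).exists
    exact (hξ.continuousOn (Frequently.of_forall fun n => (hwc n _).continuousOn)).continuousAt hKθ
  refine hsq.sqrt.congr fun θ => Real.sqrt_sq ?_
  rw [(hksd θ).2.2]
  exact norm_nonneg _
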